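/- Let $\mathbb{O}_c$ be the real (compact, 8-dimensional division) algebra of octonions and let $\mathbb{O}=\mathbb{C}\otimes_{\mathbb{R}}\mathbb{O}_c$ be the complex Cayley algebra, with the product, the Cayley conjugation $a\mapsto\tilde a$ and the norm $n(a)=a\tilde a$ extended $\mathbb{C}$-linearly (respectively as a complex quadratic form) from $\mathbb{O}_c$, with the $\mathbb C$-bilinear form $(a:b)=n(a+b)-n(a)-n(b)$, and with the complex conjugation $a\mapsto\bar a$ relative to the real form $\mathbb{O}_c$. Let $H_3(\mathbb{O})$ be the complex vector space of $3\times3$ matrices over $\mathbb{O}$ that are Hermitian with respect to the Cayley conjugation, written $$a=\begin{pmatrix}\alpha_1&a_3&\tilde a_2\\ \tilde a_3&\alpha_2&a_1\\ a_2&\tilde a_1&\alpha_3\end{pmatrix}=\sum_i\alpha_ie_i+\sum_iF_i(a_i)\qquad(\alpha_i\in\mathbb{C},\ a_i\in\mathbb{O}).$$ Put $(a:b)=\sum_i\alpha_i\beta_i+\sum_i(a_i:b_i)$, $\ \bar a=\sum_i\bar\alpha_ie_i+\sum_iF_i(\bar a_i)$, $\ (a\mid b)=(a:\bar b)$, $$a^{\#}=\sum_i(\alpha_j\alpha_k-n(a_i))\,e_i+\sum_iF_i\bigl((a_ja_k-\alpha_i\tilde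 a_i)^{\sim}\bigr),$$ where $(i,j,k)$ denotes the even permutation of $(1,2,3)$ starting with $i$, and $$a\times b=(a+b)^{\#}-a^{\#}-b^{\#},\qquad \det a=\tfrac13(a^{\#}:a).$$ Define the operators $$D(x,y)z=(x\mid y)z+(z\mid y)x-(x\times z)\times\bar y,\qquad Q(x)y=(x\mid y)x-x^{\#}\times\bar y,$$ and the Bergman operator $B(x,y)=\mathrm{id}-D(x,y)+Q(x)Q(y)$. The operators $D(x,y)$ and $B(x,y)$ are $\mathbb{C}$-linear. Then for all $x,y\in H_3(\mathbb{O})$, $$\operatorname{Tr}D(x,y)=18\,(x\mid y),$$ $$\operatorname{Det}B(x,y)=\bigl(1-(x\mid y)+(x^{\#}\mid y^{\#})-\det x\,\det\bar y\bigr)^{18},$$ where $\operatorname{Tr}$ and $\operatorname{Det}$ are the trace and the determinant of $\mathbb{C}$-linear operators on $H_3(\mathbb{O})$. -/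

import Mathlib

namespace ExceptionalJordan

/-- The Cayley algebra over `R`, as the Cayley--Dickson double `A ⊕ vA`, `v ^ 2 = -1`, of the
quaternion algebra `A` over `R` (basis `1, i, j, k` with `i ^ 2 = j ^ 2 = -1`).
The element `⟨a, b⟩` stands for `a + v b`. For `R = ℝ` this is the compact
Cayley algebra of octonions; for `R = ℂ` it is its complexification. -/
@[ext]
structure Octonion (R : Type) [CommRing R] where
  /-- the component `a` of `a + v b` -/
  fst : Quaternion R
  /-- the component `b` of `a + v b` -/
  snd : Quaternion R

namespace Octonion

variable {R : Type} [CommRing R]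

instance : Zero (Octonion R) := ⟨⟨0, 0⟩⟩
instance : One (Octonion R) := ⟨⟨1, 0⟩⟩
instance : Add (Octonion R) := ⟨fun a b => ⟨a.fst + b.fst, a.snd + b.snd⟩⟩
instance : Neg (Octonion R) := ⟨fun a => ⟨-a.fst, -a.snd⟩⟩
instance : Sub (Octonion R) := ⟨fun a b => ⟨a.fst - b.fst, a.snd - b.snd⟩⟩
instance : SMul R (Octonion R) := ⟨fun c a => ⟨c • a.fst, c • a.snd⟩⟩

/-- The product
`(a₁ + v b₁) (a₂ + v b₂) = a₁ a₂ + μ b₂ b₁~ + v (a₁~ b₂ + a₂ b₁)` with `μ = -1`, where `~` is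
the `R`-linear conjugation of the quaternion algebra. -/
instance : Mul (Octonion R) :=
  ⟨fun a b => ⟨a.fst * b.fst - b.snd * star a.snd, star a.fst * b.snd + b.fst * a.snd⟩⟩

/-- The Cayley conjugation `(a + v b)~ = a~ - v b`; it is `R`-linear, also for `R = ℂ`. -/
instance : Star (Octonion R) := ⟨fun a => ⟨star a.fst, -a.snd⟩⟩

@[simp] theorem zero_fst : (0 : Octonion R).fst = 0 := rfl
@[simp] theorem zero_snd : (0 : Octonion R).snd = 0 := rfl
@[simp] theorem one_fst : (1 : Octonion R).fst = 1 := rfl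
@[simp] theorem one_snd : (1 : Octonion R).snd = 0 := rfl
@[simp] theorem add_fst (a b : Octonion R) : (a + b).fst = a.fst + b.fst := rfl
@[simp] theorem add_snd (a b : Octonion R) : (a + b).snd = a.snd + b.snd := rfl
@[simp] theorem neg_fst (a : Octonion R) : (-a).fst = -a.fst := rfl
@[simp] theorem neg_snd (a : Octonion R) : (-a).snd = -a.snd := rfl
@[simp] theorem sub_fst (a b : Octonion R) : (a - b).fst = a.fst - b.fst := rfl
@[simp] theorem sub_snd (a b : Octonion R) : (a - b).snd = a.snd - b.snd := rfl
@[simp] theorem smul_fst (c : R) (a : Octonion R) : (c • a).fst = c • a.fst := rfl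
@[simp] theorem smul_snd (c : R) (a : Octonion R) : (c • a).snd = c • a.snd := rfl
@[simp] theorem star_fst (a : Octonion R) : (star a).fst = star a.fst := rfl
@[simp] theorem star_snd (a : Octonion R) : (star a).snd = -a.snd := rfl
@[simp] theorem mul_fst (a b : Octonion R) :
    (a * b).fst = a.fst * b.fst - b.snd * star a.snd := rfl
@[simp] theorem mul_snd (a b : Octonion R) :
    (a * b).snd = star a.fst * b.snd + b.fst * a.snd := rfl

instance : AddCommGroup (Octonion R) where
  add_assoc a b c := by ext1 <;> simp [add_assoc]
  zero_add a := by ext1 <;> simp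
  add_zero a := by ext1 <;> simp
  add_comm a b := by ext1 <;> simp [add_comm]
  neg_add_cancel a := by ext1 <;> simp
  sub_eq_add_neg a b := by ext1 <;> simp [sub_eq_add_neg]
  nsmul := nsmulRec
  zsmul := zsmulRec

instance : Module R (Octonion R) where
  one_smul a := by ext1 <;> simp
  mul_smul c d a := by ext1 <;> simp [mul_smul]
  smul_zero c := by ext1 <;> simp
  smul_add c a b := by ext1 <;> simp
  add_smul c d a := by ext1 <;> simp [add_smul]
  zero_smul a := by ext1 <;> simp

instance : NonAssocRing (Octonion R) where
  left_distrib a b c := by ext1 <;> simp [mul_add, add_mul] <;> abel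
  right_distrib a b c := by ext1 <;> simp [mul_add, add_mul] <;> abel
  zero_mul a := by ext1 <;> simp
  mul_zero a := by ext1 <;> simp
  one_mul a := by ext1 <;> simp
  mul_one a := by ext1 <;> simp

theorem smul_mul (c : R) (a b : Octonion R) : (c • a) * b = c • (a * b) := by
  ext1 <;> simp [smul_sub]

theorem mul_smul' (c : R) (a b : Octonion R) : a * (c • b) = c • (a * b) := by
  ext1 <;> simp [smul_sub]

instance : StarAddMonoid (Octonion R) where
  star_involutive a := by ext1 <;> simp
  star_add a b := by ext1 <;> simp [add_comm]

theorem star_smul' (c : R) (a : Octonion R) : star (c • a) = c • star a := by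
  ext1 <;> simp

/-- The norm `n (a + v b) = n a + n b`, a quadratic form with values in `R`. -/
def norm (a : Octonion R) : R := Quaternion.normSq a.fst + Quaternion.normSq a.snd

/-- The scalar product `(a : b) = n (a + b) - n a - n b`, without a factor `1 / 2`. -/
def bil (a b : Octonion R) : R := norm (a + b) - norm a - norm b

/-- `a a~ = a~ a = n a`. -/
theorem mul_star_self (a : Octonion R) : a * star a = norm a • 1 ∧ star a * a = norm a • 1 := by
  constructor <;> ext <;>
    simp [norm, Quaternion.normSq_def', Quaternion.re_one, Quaternion.imI_one,
      Quaternion.imJ_one, Quaternion.imK_one] <;>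
    ring

/-- The norm is multiplicative: the Cayley algebra is a composition algebra. -/
theorem norm_mul (a b : Octonion R) : norm (a * b) = norm a * norm b := by
  simp [norm, Quaternion.normSq_def']
  ring

theorem bil_eq (a b : Octonion R) : bil a b =
    2 * (a.fst.re * b.fst.re + a.fst.imI * b.fst.imI + a.fst.imJ * b.fst.imJ
      + a.fst.imK * b.fst.imK + a.snd.re * b.snd.re + a.snd.imI * b.snd.imI
      + a.snd.imJ * b.snd.imJ + a.snd.imK * b.snd.imK) := by
  simp [bil, norm, Quaternion.normSq_def']
  ring

theorem bil_add_left (a b c : Octonion R) : bil (a + b) c = bil a c + bil b c := by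
  simp [bil_eq]; ring

theorem bil_smul_left (r : R) (a b : Octonion R) : bil (r • a) b = r * bil a b := by
  simp [bil_eq]; ring

theorem bil_comm (a b : Octonion R) : bil a b = bil b a := by
  simp [bil_eq]; ring

/-- Application of a map to the eight coordinates of an element of a Cayley algebra. -/
def mapCoord {S : Type} [CommRing S] (f : R → S) (a : Octonion R) : Octonion S :=
  ⟨⟨f a.fst.re, f a.fst.imI, f a.fst.imJ, f a.fst.imK⟩,
    ⟨f a.snd.re, f a.snd.imI, f a.snd.imJ, f a.snd.imK⟩⟩

section mapCoord

variable {S : Type} [CommRing S] (f : R → S) (a : Octonion R)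

@[simp] theorem mapCoord_fst_re : (mapCoord f a).fst.re = f a.fst.re := rfl
@[simp] theorem mapCoord_fst_imI : (mapCoord f a).fst.imI = f a.fst.imI := rfl
@[simp] theorem mapCoord_fst_imJ : (mapCoord f a).fst.imJ = f a.fst.imJ := rfl
@[simp] theorem mapCoord_fst_imK : (mapCoord f a).fst.imK = f a.fst.imK := rfl
@[simp] theorem mapCoord_snd_re : (mapCoord f a).snd.re = f a.snd.re := rfl
@[simp] theorem mapCoord_snd_imI : (mapCoord f a).snd.imI = f a.snd.imI := rfl
@[simp] theorem mapCoord_snd_imJ : (mapCoord f a).snd.imJ = f a.snd.imJ := rfl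
@[simp] theorem mapCoord_snd_imK : (mapCoord f a).snd.imK = f a.snd.imK := rfl

end mapCoord

/-- The complex conjugation of the complex Cayley algebra with respect to its real form, the
compact Cayley algebra: complex conjugation of the eight coordinates. -/
noncomputable def conj (a : Octonion ℂ) : Octonion ℂ := mapCoord (starRingEnd ℂ) a

theorem conj_add (a b : Octonion ℂ) : conj (a + b) = conj a + conj b := by
  ext <;> simp [conj]

theorem conj_smul (c : ℂ) (a : Octonion ℂ) :
    conj (c • a) = (starRingEnd ℂ) c • conj a := by
  ext <;> simp [conj]

/-- The inclusion of the compact Cayley algebra in the complex Cayley algebra. -/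
noncomputable def ofReal (a : Octonion ℝ) : Octonion ℂ := mapCoord Complex.ofReal a

theorem ofReal_mul (a b : Octonion ℝ) : ofReal (a * b) = ofReal a * ofReal b := by
  ext <;> simp [ofReal]

/-- The complex Cayley algebra is the complexification of the compact one, and `conj` is the
complex conjugation attached to this real form. -/
theorem existsUnique_ofReal (a : Octonion ℂ) :
    ∃! p : Octonion ℝ × Octonion ℝ, a = ofReal p.1 + Complex.I • ofReal p.2 ∧
      conj a = ofReal p.1 - Complex.I • ofReal p.2 := by
  refine ⟨⟨mapCoord Complex.re a, mapCoord Complex.im a⟩, ⟨?_, ?_⟩, ?_⟩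
  · ext <;> apply Complex.ext <;> simp [ofReal]
  · ext <;> apply Complex.ext <;> simp [ofReal, conj]
  · rintro ⟨p, q⟩ ⟨rfl, -⟩
    ext <;> simp [ofReal]

end Octonion

/-- The `ℂ`-vector space of `3 × 3` matrices over the complex Cayley algebra that are Hermitian
with respect to the Cayley conjugation. -/
def H3 : Submodule ℂ (Matrix (Fin 3) (Fin 3) (Octonion ℂ)) where
  carrier := {A | A.IsHermitian}
  add_mem' hA hB := Matrix.IsHermitian.add hA hB
  zero_mem' := Matrix.isHermitian_zero
  smul_mem' c A hA := Matrix.IsHermitian.ext fun i j => by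
    rw [Matrix.smul_apply, Matrix.smul_apply, Octonion.star_smul', Matrix.IsHermitian.apply hA]

/-- The diagonal coordinates `αᵢ` of a Hermitian matrix (its diagonal entries are the scalars
`αᵢ • 1`). -/
def diag (a : H3) (i : Fin 3) : ℂ := (a.1 i i).fst.re

/-- The off-diagonal coordinates: `a₁`, `a₂`, `a₃` are the entries in the places
`(2, 3)`, `(3, 1)`, `(1, 2)`. -/
def off (a : H3) (i : Fin 3) : Octonion ℂ := a.1 (i + 1) (i + 2)

/-- The Hermitian matrix `∑ αᵢ eᵢ + ∑ Fᵢ(aᵢ)`. -/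
def of (α : Fin 3 → ℂ) (a : Fin 3 → Octonion ℂ) : H3 :=
  ⟨!![α 0 • 1, a 2, star (a 1);
      star (a 2), α 1 • 1, a 0;
      a 1, star (a 0), α 2 • 1], Matrix.IsHermitian.ext fun i j => by
    fin_cases i <;> fin_cases j <;> simp <;> ext <;> simp⟩

@[simp] theorem diag_of (α : Fin 3 → ℂ) (a : Fin 3 → Octonion ℂ) (i : Fin 3) :
    diag (of α a) i = α i := by
  fin_cases i <;> simp [diag, of, Quaternion.re_one]

@[simp] theorem off_of (α : Fin 3 → ℂ) (a : Fin 3 → Octonion ℂ) (i : Fin 3) :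
    off (of α a) i = a i := by
  fin_cases i <;> simp [off, of]

theorem of_diag_off (a : H3) : of (diag a) (off a) = a := by
  obtain ⟨A, hA⟩ := a
  have key : ∀ i, A i i = (A i i).fst.re • (1 : Octonion ℂ) := fun i => by
    have h := Matrix.IsHermitian.apply hA i i
    have hf := Quaternion.ext_iff.mp (congrArg Octonion.fst h)
    have hs := Quaternion.ext_iff.mp (congrArg Octonion.snd h)
    simp only [Octonion.star_fst, Octonion.star_snd, Quaternion.re_star, Quaternion.imI_star,
      Quaternion.imJ_star, Quaternion.imK_star, Quaternion.re_neg, Quaternion.imI_neg,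
      Quaternion.imJ_neg, Quaternion.imK_neg, neg_eq_self] at hf hs
    ext <;> simp [hf, hs, Quaternion.re_one, Quaternion.imI_one, Quaternion.imJ_one,
      Quaternion.imK_one, Quaternion.re_zero, Quaternion.imI_zero, Quaternion.imJ_zero,
      Quaternion.imK_zero]
  apply Subtype.ext
  apply Matrix.ext
  intro i j
  have hs := Matrix.IsHermitian.apply hA
  fin_cases i <;> fin_cases j <;> simp [of, diag, off, ← key, hs]

theorem H3_ext {a b : H3} (h₁ : ∀ i, diag a i = diag b i) (h₂ : ∀ i, off a i = off b i) :
    a = b := by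
  rw [← of_diag_off a, ← of_diag_off b, funext h₁, funext h₂]

@[simp] theorem diag_add (a b : H3) (i : Fin 3) : diag (a + b) i = diag a i + diag b i := rfl
@[simp] theorem diag_sub (a b : H3) (i : Fin 3) : diag (a - b) i = diag a i - diag b i := rfl
@[simp] theorem diag_smul (c : ℂ) (a : H3) (i : Fin 3) : diag (c • a) i = c * diag a i := rfl
@[simp] theorem off_add (a b : H3) (i : Fin 3) : off (a + b) i = off a i + off b i := rfl
@[simp] theorem off_sub (a b : H3) (i : Fin 3) : off (a - b) i = off a i - off b i := rfl
@[simp] theorem off_smul (c : ℂ) (a : H3) (i : Fin 3) : off (c • a) i = c • off a i := rfl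

/-- The scalar product `(a : b) = ∑ αᵢ βᵢ + ∑ (aᵢ : bᵢ)`. -/
def bil (a b : H3) : ℂ := ∑ i, diag a i * diag b i + ∑ i, Octonion.bil (off a i) (off b i)

/-- The adjoint
`a# = ∑ᵢ (αⱼ αₖ - n aᵢ) eᵢ + ∑ᵢ Fᵢ((aⱼ aₖ - αᵢ aᵢ~)~)`, where `(i, j, k)` runs through the
even permutations of the three indices, i.e. `j = i + 1` and `k = i + 2` modulo `3`. -/
def adj (a : H3) : H3 :=
  of (fun i => diag a (i + 1) * diag a (i + 2) - Octonion.norm (off a i))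
    (fun i => star (off a (i + 1) * off a (i + 2) - diag a i • star (off a i)))

/-- The Freudenthal product `a × b = (a + b)# - a# - b#`. -/
def cross (a b : H3) : H3 := adj (a + b) - adj a - adj b

/-- The determinant `det a = (1 / 3!) (a × a : a) = (1 / 3) (a# : a)`. -/
noncomputable def det (a : H3) : ℂ := (1 / 3) * bil (adj a) a

/-- The complex conjugation, applied to all coordinates. -/
noncomputable def conj (a : H3) : H3 :=
  of (fun i => (starRingEnd ℂ) (diag a i)) (fun i => Octonion.conj (off a i))

/-- The Hermitian scalar product `(a | b) = (a : b̄)`, linear in `a`, antilinear in `b`. -/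
noncomputable def herm (a b : H3) : ℂ := bil a (conj b)

theorem bil_add_left (a b c : H3) : bil (a + b) c = bil a c + bil b c := by
  simp only [bil, diag_add, off_add, add_mul, Octonion.bil_add_left, Finset.sum_add_distrib]
  ring

theorem bil_smul_left (r : ℂ) (a b : H3) : bil (r • a) b = r * bil a b := by
  simp only [bil, diag_smul, off_smul, Octonion.bil_smul_left, mul_add, Finset.mul_sum, mul_assoc]

theorem bil_comm (a b : H3) : bil a b = bil b a := by
  simp only [bil, mul_comm, Octonion.bil_comm]

theorem diag_cross (a b : H3) (i : Fin 3) : diag (cross a b) i =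
    diag a (i + 1) * diag b (i + 2) + diag a (i + 2) * diag b (i + 1)
      - Octonion.bil (off a i) (off b i) := by
  simp only [cross, adj, diag_sub, diag_of, diag_add, off_add, Octonion.bil]
  ring

theorem off_cross (a b : H3) (i : Fin 3) : off (cross a b) i =
    star (off a (i + 1) * off b (i + 2) + off b (i + 1) * off a (i + 2)
      - diag a i • star (off b i) - diag b i • star (off a i)) := by
  simp only [cross, adj, off_sub, off_of, diag_add, off_add, mul_add, add_mul, add_smul, smul_add,
    star_add, star_sub]
  abel

theorem cross_comm (a b : H3) : cross a b = cross b a := by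
  simp only [cross, add_comm a b, sub_right_comm]

theorem cross_add_left (a b c : H3) : cross (a + b) c = cross a c + cross b c := by
  refine H3_ext (fun i => ?_) (fun i => ?_)
  · simp only [diag_cross, diag_add, off_add, Octonion.bil_add_left]
    ring
  · simp only [off_cross, diag_add, off_add, mul_add, add_mul, add_smul, smul_add,
      star_add, star_sub]
    abel

theorem cross_smul_left (r : ℂ) (a b : H3) : cross (r • a) b = r • cross a b := by
  refine H3_ext (fun i => ?_) (fun i => ?_)
  · simp only [diag_cross, diag_smul, off_smul, Octonion.bil_smul_left]
    ring
  · simp only [off_cross, diag_smul, off_smul, Octonion.smul_mul, Octonion.mul_smul',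
      Octonion.star_smul', smul_sub, smul_add, star_add, star_sub, mul_smul, smul_comm r]

theorem cross_add_right (a b c : H3) : cross a (b + c) = cross a b + cross a c := by
  rw [cross_comm, cross_add_left, cross_comm b, cross_comm c]

theorem cross_smul_right (r : ℂ) (a b : H3) : cross a (r • b) = r • cross a b := by
  rw [cross_comm, cross_smul_left, cross_comm b]

theorem conj_add (a b : H3) : conj (a + b) = conj a + conj b :=
  H3_ext (fun i => by simp [conj]) (fun i => by simp [conj, Octonion.conj_add])

theorem conj_smul (c : ℂ) (a : H3) : conj (c • a) = (starRingEnd ℂ) c • conj a :=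
  H3_ext (fun i => by simp [conj]) (fun i => by simp [conj, Octonion.conj_smul])

/-- The operator `D(x, y) z = {x y z} = (x | y) z + (z | y) x - (x × z) × ȳ`, which is
`ℂ`-linear in `z`. -/
noncomputable def D (x y : H3) : H3 →ₗ[ℂ] H3 where
  toFun z := herm x y • z + herm z y • x - cross (cross x z) (conj y)
  map_add' z w := by
    simp only [herm, bil_add_left, cross_add_right, cross_add_left, smul_add, add_smul]
    abel
  map_smul' c z := by
    simp only [herm, bil_smul_left, cross_smul_right, cross_smul_left, smul_add, smul_sub,
      mul_smul, smul_comm c, RingHom.id_apply]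

/-- The operator `Q(x) y = (x | y) x - x# × ȳ`, which is `ℂ`-antilinear in `y`. -/
noncomputable def Q (x : H3) : H3 →ₛₗ[starRingEnd ℂ] H3 where
  toFun y := herm x y • x - cross (adj x) (conj y)
  map_add' y z := by
    simp only [herm, conj_add, bil_comm x, bil_add_left, cross_add_right, add_smul]
    abel
  map_smul' c y := by
    simp only [herm, conj_smul, bil_comm x, bil_smul_left, cross_smul_right, smul_sub, mul_smul]

/-- The Bergman operator `B(x, y) = id - D(x, y) + Q(x) Q(y)`, which is `ℂ`-linear. -/
noncomputable def B (x y : H3) : H3 →ₗ[ℂ] H3 := LinearMap.id - D x y + (Q x).comp (Q y)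

end ExceptionalJordan

/-! Put `w = conj y`. Then `D x y` becomes the bilinear operator `V x w`, and `Q x` composed with `Q
y` becomes `U x ∘ₗ U w`, so both formulas are statements over ℂ about the cubic form `det`, and
conjugation plays no further part.

Trace: `V x w` is `(x : w)` times the identity, plus an operator of rank one with trace `(x : w)`,
minus `z ↦ (x × z) × w`, whose trace is `10 (x : w)`. Since the dimension is 27, the total is 27 + 1
- 10 = 18.

Determinant: everything rests on the adjoint identity `adj_adj` and its linearizations. They give
`U_comp_U_adj`, which makes `U (adj x)` an inverse of `U x` up to the factor `det x ^ 2`, and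
`U_comp_U₂_adj`, which turns the logarithmic derivative of `U` into an operator `V`. By Jacobi's
formula and the trace formula, the determinant `f` of `U` along a line satisfies `g f' = 18 g' f`,
where `g` is `det` along that line; both are 1 at the unit element, hence `f = g ^ 18` (`det_U`).

If `det x ≠ 0`, write `x⁻¹ = x# / det x`. The Bergman operator factors as `U x ∘ₗ U (x⁻¹ - w)`
(`bergman_comp`), and `det x * det (x⁻¹ - w)` expands to the generic norm. The case `det x = 0`
follows because both sides are polynomials on the line through the unit element and `x`. -/

namespace ExceptionalJordan

/-! ### Identities in the Cayley algebra. -/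

namespace Octonion

variable {R : Type} [CommRing R]

theorem norm_star (a : Octonion R) : norm (star a) = norm a := by
  simp [norm, Quaternion.normSq_def']

theorem norm_smul (r : R) (a : Octonion R) : norm (r • a) = r ^ 2 * norm a := by
  simp [norm, Quaternion.normSq_def']
  ring

theorem norm_sub (a b : Octonion R) : norm (a - b) = norm a + norm b - bil a b := by
  simp [norm, Quaternion.normSq_def', bil_eq]
  ring

theorem bil_self (a : Octonion R) : bil a a = 2 * norm a := by
  simp [norm, Quaternion.normSq_def', bil_eq]
  ring

theorem bil_star_star (a b : Octonion R) : bil (star a) (star b) = bil a b := by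
  simp [bil_eq]

theorem bil_sub_left (a b c : Octonion R) : bil (a - b) c = bil a c - bil b c := by
  simp [bil_eq]; ring

theorem bil_neg_left (a b : Octonion R) : bil (-a) b = -bil a b := by
  simp [bil_eq]; ring

/-- Both sides are the trace of a triple product, which is invariant under cyclic permutation
although the algebra is not associative. This gives the symmetry of the cubic form. -/
theorem bil_mul_star_cycle (a b c : Octonion R) :
    bil (a * b) (star c) = bil (b * c) (star a) := by
  simp [bil_eq]; ring

/-- Linearization of `norm_mul` in the second factor. -/
theorem bil_mul_mul_left (a b c : Octonion R) : bil (a * b) (a * c) = norm a * bil b c := by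
  simp only [bil, ← mul_add, norm_mul]; ring

theorem bil_mul_mul_right (a b c : Octonion R) : bil (b * a) (c * a) = norm a * bil b c := by
  simp only [bil, ← add_mul, norm_mul]; ring

set_option maxHeartbeats 1000000 in
/-- The Moufang identity `a (c b) a = (a : (c b)~) a - n(a) (c b)~`, for conjugates. -/
theorem star_mul_star_mul_star_mul_star (a b c : Octonion R) :
    (star a * star c) * (star b * star a)
      = bil (b * c) (star a) • star a - norm a • (b * c) := by
  rw [bil_eq, norm, Quaternion.normSq_def', Quaternion.normSq_def']
  ext <;> simp <;> ring

theorem star_mul_star_mul_self (a b : Octonion R) :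
    (star a * star b) * b = norm b • star a := by
  ext <;> simp [norm, Quaternion.normSq_def'] <;> ring

theorem self_mul_star_mul_star (a b : Octonion R) :
    a * (star a * star b) = norm a • star b := by
  ext <;> simp [norm, Quaternion.normSq_def'] <;> ring

theorem star_mul' (a b : Octonion R) : star (a * b) = star b * star a := by
  ext <;> simp

end Octonion

/-! ### The cubic form and the adjoint identity with its linearizations. -/

theorem off_adj (a : H3) (i : Fin 3) : off (adj a) i =
    star (off a (i + 1) * off a (i + 2) - diag a i • star (off a i)) := by
  simp [adj]

theorem diag_adj (a : H3) (i : Fin 3) : diag (adj a) i =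
    diag a (i + 1) * diag a (i + 2) - Octonion.norm (off a i) := by
  simp [adj]

theorem cross_self (a : H3) : cross a a = (2 : ℂ) • adj a := by
  refine H3_ext (fun i => ?_) (fun i => ?_)
  · simp only [diag_cross, diag_smul, diag_adj, Octonion.bil_self]
    ring
  · simp only [off_cross, off_smul, off_adj, ← Octonion.star_smul']
    congr 1
    module

theorem adj_add (a b : H3) : adj (a + b) = adj a + adj b + cross a b := by
  simp [cross]

theorem adj_smul (r : ℂ) (a : H3) : adj (r • a) = r ^ 2 • adj a := by
  have h := cross_self (r • a)
  rw [cross_smul_left, cross_smul_right, cross_self] at h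
  linear_combination (norm := module) (-1 / 2 : ℂ) • h

theorem bil_add_right (a b c : H3) : bil a (b + c) = bil a b + bil a c := by
  rw [bil_comm, bil_add_left, bil_comm b, bil_comm c]

theorem bil_smul_right (r : ℂ) (a b : H3) : bil a (r • b) = r * bil a b := by
  rw [bil_comm, bil_smul_left, bil_comm b]

theorem bil_cross (a b c : H3) : bil (cross a b) c =
    (diag a 1 * diag b 2 + diag a 2 * diag b 1) * diag c 0
    + (diag a 2 * diag b 0 + diag a 0 * diag b 2) * diag c 1
    + (diag a 0 * diag b 1 + diag a 1 * diag b 0) * diag c 2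
    - ∑ i, (diag c i * Octonion.bil (off a i) (off b i)
      + diag a i * Octonion.bil (off b i) (off c i)
      + diag b i * Octonion.bil (off a i) (off c i))
    + ∑ i, (Octonion.bil (off a (i + 1) * off b (i + 2)) (star (off c i))
      + Octonion.bil (off b (i + 1) * off a (i + 2)) (star (off c i))) := by
  have h (i : Fin 3) : Octonion.bil (off (cross a b) i) (off c i) =
      Octonion.bil (off a (i + 1) * off b (i + 2)) (star (off c i))
      + Octonion.bil (off b (i + 1) * off a (i + 2)) (star (off c i))
      - diag a i * Octonion.bil (off b i) (off c i)
      - diag b i * Octonion.bil (off a i) (off c i) := by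
    rw [off_cross, ← Octonion.bil_star_star, star_star]
    simp only [Octonion.bil_sub_left, Octonion.bil_add_left, Octonion.bil_smul_left,
      Octonion.bil_star_star]
  simp only [bil, h, diag_cross, Fin.sum_univ_three, Fin.isValue, Fin.reduceAdd, zero_add]
  ring

/-- The trilinear form `(a × b : c)` is symmetric. -/
theorem bil_cross_right (a b c : H3) : bil a (cross b c) = bil (cross a b) c := by
  have h (i : Fin 3) : Octonion.bil (off a (i + 1) * off b (i + 2)) (star (off c i))
      = Octonion.bil (off b (i + 2) * off c i) (star (off a (i + 1))) :=
    Octonion.bil_mul_star_cycle _ _ _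
  have h' (i : Fin 3) : Octonion.bil (off b (i + 1) * off a (i + 2)) (star (off c i))
      = Octonion.bil (off c i * off b (i + 1)) (star (off a (i + 2))) := by
    rw [Octonion.bil_mul_star_cycle, Octonion.bil_mul_star_cycle]
  rw [bil_comm, bil_cross, bil_cross]
  simp only [Fin.sum_univ_three, Fin.isValue, Fin.reduceAdd, zero_add, h, h',
    Octonion.bil_comm (off c _) (off a _), Octonion.bil_comm (off b _) (off a _)]
  ring

theorem det_add_smul (x z : H3) (t : ℂ) : det (x + t • z) =
    det x + t * bil (adj x) z + t ^ 2 * bil x (adj z) + t ^ 3 * det z := by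
  have h (u v : H3) : bil (cross u v) u = 2 * bil (adj u) v := by
    rw [cross_comm, ← bil_cross_right, cross_self, bil_smul_right, bil_comm]
  simp only [det, adj_add, adj_smul, cross_smul_right, bil_add_left, bil_add_right, bil_smul_left,
    bil_smul_right, h x z]
  rw [cross_comm x z, h z x, bil_comm (adj z) x]
  ring

theorem bil_adj_self (x : H3) : bil (adj x) x = 3 * det x := by
  rw [det]; ring

theorem det_eq (x : H3) : det x = diag x 0 * diag x 1 * diag x 2
    - ∑ i, diag x i * Octonion.norm (off x i)
    + Octonion.bil (off x 1 * off x 2) (star (off x 0)) := by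
  have h := bil_cross x x x
  rw [cross_self, bil_smul_left, bil_adj_self] at h
  have h1 := Octonion.bil_mul_star_cycle (off x 0) (off x 1) (off x 2)
  have h2 := Octonion.bil_mul_star_cycle (off x 2) (off x 0) (off x 1)
  simp only [Octonion.bil_self, Fin.sum_univ_three, Fin.isValue, Fin.reduceAdd, zero_add] at h ⊢
  -- `h` computes `(x × x : x) = 6 det x`; its three cyclic octonion terms coincide by `h1` and
  -- `h2`.
  linear_combination h / 6 + h1 * (2 / 3) + h2 / 3

/-- The cyclically rotated expansion, so that `adj_adj` can be checked at all three indices at once.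
-/
theorem det_eq' (x : H3) (i : Fin 3) : det x = diag x i * diag x (i + 1) * diag x (i + 2)
    - (diag x i * Octonion.norm (off x i) + diag x (i + 1) * Octonion.norm (off x (i + 1))
      + diag x (i + 2) * Octonion.norm (off x (i + 2)))
    + Octonion.bil (off x (i + 1) * off x (i + 2)) (star (off x i)) := by
  have h1 := Octonion.bil_mul_star_cycle (off x 0) (off x 1) (off x 2)
  have h2 := Octonion.bil_mul_star_cycle (off x 2) (off x 0) (off x 1)
  rw [det_eq, Fin.sum_univ_three]
  fin_cases i <;> simp only [Fin.isValue, Fin.reduceAdd, Fin.zero_eta, Fin.mk_one, Fin.reduceFinMk,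
    zero_add]
  · linear_combination -h1 - h2
  · linear_combination -h1

/-- The diagonal part uses that the norm is multiplicative; the off-diagonal part uses a Moufang
identity and alternativity. -/
theorem adj_adj (x : H3) : adj (adj x) = det x • x := by
  have e1 (i : Fin 3) : i + 1 + 1 = i + 2 := by fin_cases i <;> rfl
  have e2 (i : Fin 3) : i + 1 + 2 = i := by fin_cases i <;> rfl
  have e3 (i : Fin 3) : i + 2 + 1 = i := by fin_cases i <;> rfl
  have e4 (i : Fin 3) : i + 2 + 2 = i + 1 := by fin_cases i <;> rfl
  refine H3_ext (fun i => ?_) (fun i => ?_)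
  · rw [det_eq' x i]
    simp only [diag_adj, off_adj, diag_smul, e1, e2, e3, e4, Octonion.norm_star,
      Octonion.norm_sub, Octonion.norm_smul, Octonion.norm_mul]
    rw [Octonion.bil_comm (_ * _) (_ • _), Octonion.bil_smul_left,
      Octonion.bil_comm (star _) (_ * _)]
    ring
  · have h : off (adj x) (i + 1) * off (adj x) (i + 2) - diag (adj x) i • star (off (adj x) i)
        = det x • star (off x i) := by
      rw [det_eq' x i]
      simp only [diag_adj, off_adj, e1, e2, e3, e4, Octonion.star_smul', star_sub,
        star_star, sub_mul, mul_sub, Octonion.smul_mul, Octonion.mul_smul', Octonion.star_mul',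
        Octonion.star_mul_star_mul_star_mul_star, Octonion.star_mul_star_mul_self,
        Octonion.self_mul_star_mul_star]
      module
    rw [off_adj (adj x), h, off_smul, Octonion.star_smul', star_star]

theorem det_adj (x : H3) : det (adj x) = det x ^ 2 := by
  rw [det, adj_adj, bil_smul_left, bil_comm, bil_adj_self]
  ring

/-- The first linearization of `x## = det x • x`. -/
theorem cross_adj_cross (x z : H3) :
    cross (adj x) (cross x z) = bil (adj x) z • x + det x • z := by
  have h (t : ℂ) := adj_adj (x + t • z)
  simp only [det_add_smul, adj_add, adj_smul, cross_add_left, cross_smul_left,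
    cross_smul_right, adj_adj] at h
  -- Both sides of `h t` have degree at most 4 in `t`; the five-point difference formula, whose
  -- weight at 0 is zero, extracts the coefficient of `t` exactly.
  linear_combination (norm := module) (2 / 3 : ℂ) • h 1 - (2 / 3 : ℂ) • h (-1)
    - (1 / 12 : ℂ) • h 2 + (1 / 12 : ℂ) • h (-2)

/-- The second linearization of `x## = det x • x`. -/
theorem cross_adj_cross_cross (x y z : H3) :
    cross (adj x) (cross y z) + cross (cross x y) (cross x z)
      = bil (adj x) y • z + bil (adj x) z • y + bil (cross x y) z • x := by
  have h1 := cross_adj_cross (x + (1 : ℂ) • y) z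
  have h2 := cross_adj_cross (x + (-1 : ℂ) • y) z
  have h3 := cross_adj_cross y z
  simp only [det_add_smul, adj_add, adj_smul, cross_add_left, cross_add_right, cross_smul_left,
    cross_smul_right, bil_add_left, bil_smul_left] at h1 h2
  -- The odd part in `t`, taken at `t = ±1`, is the sum of the coefficients of `t` and `t ^ 3`; the
  -- latter is `h3`.
  linear_combination (norm := module) (1 / 2 : ℂ) • h1 - (1 / 2 : ℂ) • h2 - h3

/-! ### Orthogonal basis and traces. -/

namespace Octonion

variable {R : Type} [CommRing R]

/-- The eight coordinates of an element of a Cayley algebra. -/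
def equivFun : Octonion R ≃ₗ[R] (Fin 8 → R) where
  toFun a := ![a.fst.re, a.fst.imI, a.fst.imJ, a.fst.imK,
    a.snd.re, a.snd.imI, a.snd.imJ, a.snd.imK]
  invFun f := ⟨⟨f 0, f 1, f 2, f 3⟩, ⟨f 4, f 5, f 6, f 7⟩⟩
  map_add' a b := by ext k; fin_cases k <;> rfl
  map_smul' c a := by ext k; fin_cases k <;> rfl
  left_inv _ := rfl
  right_inv f := by ext k; fin_cases k <;> rfl

theorem equivFun_apply (a : Octonion R) : equivFun a = ![a.fst.re, a.fst.imI, a.fst.imJ, a.fst.imK,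
    a.snd.re, a.snd.imI, a.snd.imJ, a.snd.imK] := rfl

theorem equivFun_symm_apply (f : Fin 8 → R) :
    equivFun.symm f = ⟨⟨f 0, f 1, f 2, f 3⟩, ⟨f 4, f 5, f 6, f 7⟩⟩ := rfl

theorem bil_zero_left (a : Octonion R) : bil 0 a = 0 := by
  simpa using bil_smul_left 0 0 a

theorem bil_zero_right (a : Octonion R) : bil a 0 = 0 := by
  rw [bil_comm, bil_zero_left]

theorem bil_neg_neg (a b : Octonion R) : bil (-a) (-b) = bil a b := by
  rw [bil_neg_left, bil_comm, bil_neg_left, bil_comm]; ring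

theorem bil_smul_smul (r s : R) (a b : Octonion R) : bil (r • a) (s • b) = r * s * bil a b := by
  rw [bil_smul_left, bil_comm, bil_smul_left, bil_comm]; ring

/-- The eight standard units of a Cayley algebra. -/
def unit (k : Fin 8) : Octonion R := equivFun.symm (Pi.single k 1)

theorem bil_unit (a : Octonion R) (k : Fin 8) : bil a (unit k) = 2 * equivFun a k := by
  rw [bil_eq]
  fin_cases k <;> simp [unit, equivFun_symm_apply, equivFun_apply]

theorem norm_unit (k : Fin 8) : norm (unit k : Octonion R) = 1 := by
  rw [norm, Quaternion.normSq_def', Quaternion.normSq_def']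
  fin_cases k <;> simp [unit, equivFun_symm_apply]

theorem sum_bil_unit (a b : Octonion R) :
    ∑ k, bil a (unit k) * bil b (unit k) = 2 * bil a b := by
  simp only [bil_unit, bil_eq a b, Fin.sum_univ_eight]
  simp [equivFun_apply]
  ring

end Octonion

theorem bil_diag_single (a : H3) (i : Fin 3) : bil a (of (Pi.single i 1) 0) = diag a i := by
  simp [bil, Pi.single_apply, Octonion.bil_zero_right]

theorem bil_off_single (a : H3) (i : Fin 3) (u : Octonion ℂ) :
    bil a (of 0 (Pi.single i u)) = Octonion.bil (off a i) u := by
  have h (j : Fin 3) : Octonion.bil (off a j) ((Pi.single i u : Fin 3 → Octonion ℂ) j)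
      = if j = i then Octonion.bil (off a i) u else 0 := by
    by_cases hj : j = i
    · subst hj; simp
    · simp [hj, Octonion.bil_zero_right]
  simp [bil, h]

theorem eq_of_bil_right {a b : H3} (h : ∀ w, bil a w = bil b w) : a = b := by
  refine H3_ext (fun i => ?_) (fun i => ?_)
  · rw [← bil_diag_single, h, bil_diag_single]
  · apply Octonion.equivFun.injective
    ext k
    have hk := h (of 0 (Pi.single i (Octonion.unit k)))
    rw [bil_off_single, bil_off_single, Octonion.bil_unit, Octonion.bil_unit] at hk
    exact mul_left_cancel₀ two_ne_zero hk

/-- The `27` coordinates of an element of `H3`. -/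
def equivFun : H3 ≃ₗ[ℂ] (Fin 3 ⊕ Fin 3 × Fin 8 → ℂ) where
  toFun a := Sum.elim (diag a) (fun p => Octonion.equivFun (off a p.1) p.2)
  invFun f := of (fun i => f (Sum.inl i))
    (fun i => Octonion.equivFun.symm (fun k => f (Sum.inr (i, k))))
  map_add' a b := by ext (i | i) <;> simp
  map_smul' c a := by ext (i | i) <;> simp
  left_inv a := by
    refine H3_ext (fun i => ?_) (fun i => ?_) <;> simp
  right_inv f := by ext (i | i) <;> simp

/-- The standard basis of `H3`. -/
noncomputable def basis : Module.Basis (Fin 3 ⊕ Fin 3 × Fin 8) ℂ H3 := .ofEquivFun equivFun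

/-- The standard basis is orthogonal for `bil`; the off-diagonal units have square length 2, whence
the factor `1 / 2`. -/
theorem trace_eq (T : H3 →ₗ[ℂ] H3) : LinearMap.trace ℂ H3 T =
    ∑ i, bil (T (of (Pi.single i 1) 0)) (of (Pi.single i 1) 0)
    + 1 / 2 * ∑ i, ∑ k, bil (T (of 0 (Pi.single i (Octonion.unit k))))
        (of 0 (Pi.single i (Octonion.unit k))) := by
  have h1 (i : Fin 3) : basis (Sum.inl i) = of (Pi.single i 1) 0 := by
    refine H3_ext (fun j => ?_) (fun j => ?_) <;>
      simp [basis, equivFun, Pi.single_apply]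
    rfl
  have h2 (i : Fin 3) (k : Fin 8) :
      basis (Sum.inr (i, k)) = of 0 (Pi.single i (Octonion.unit k)) := by
    refine H3_ext (fun j => ?_) (fun j => ?_)
    · simp [basis, equivFun]
    · simp only [basis, equivFun, Octonion.unit]
      by_cases hj : j = i
      · subst hj
        simp [Pi.single_apply]
        ext l
        simp [Pi.single_apply]
      · simp [hj, Pi.single_apply]
        rfl
  rw [LinearMap.trace_eq_matrix_trace ℂ basis, Matrix.trace, Fintype.sum_sum_type,
    Fintype.sum_prod_type]
  simp only [Matrix.diag_apply, LinearMap.toMatrix_apply, h1, h2, bil_diag_single, bil_off_single,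
    Octonion.bil_unit, ← Finset.mul_sum]
  simp [basis, equivFun]

theorem bil_cross_diag_single (x w : H3) (i : Fin 3) :
    bil (cross x (of (Pi.single i 1) 0)) (cross w (of (Pi.single i 1) 0)) =
      diag x (i + 1) * diag w (i + 1) + diag x (i + 2) * diag w (i + 2)
        + Octonion.bil (off x i) (off w i) := by
  simp only [bil, diag_cross, off_cross, Octonion.bil_star_star, diag_of, off_of, Fin.sum_univ_three]
  fin_cases i <;> simp [Octonion.bil_zero_right, Octonion.bil_neg_neg, Octonion.bil_star_star] <;> ring

theorem bil_cross_off_single (x w : H3) (i : Fin 3) (u : Octonion ℂ) :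
    bil (cross x (of 0 (Pi.single i u))) (cross w (of 0 (Pi.single i u))) =
      Octonion.bil (off x i) u * Octonion.bil (off w i) u
        + Octonion.norm u * (2 * (diag x i * diag w i)
          + Octonion.bil (off x (i + 1)) (off w (i + 1))
          + Octonion.bil (off x (i + 2)) (off w (i + 2))) := by
  simp only [bil, diag_cross, off_cross, Octonion.bil_star_star, diag_of, off_of, Fin.sum_univ_three]
  fin_cases i <;> simp [Octonion.bil_zero_right, Octonion.bil_neg_neg,
    Octonion.bil_smul_smul, Octonion.norm_star, Octonion.bil_mul_mul_left,
    Octonion.bil_mul_mul_right, Octonion.bil_self] <;> ring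

/-- The transpose of `cross_adj_cross` with respect to the nondegenerate form `bil`, under which
every operator `z ↦ x × z` is symmetric. -/
theorem cross_cross_adj (x z : H3) :
    cross x (cross (adj x) z) = bil x z • adj x + det x • z := by
  refine eq_of_bil_right fun w => ?_
  rw [cross_comm x, cross_comm _ z, ← bil_cross_right, ← bil_cross_right, cross_adj_cross,
    bil_add_right, bil_smul_right, bil_smul_right, bil_add_left, bil_smul_left, bil_smul_left,
    bil_comm z x]
  ring

/-- By symmetry of the trilinear form the trace is a sum of `(x × z : w × z)` over the basis. Each
product `αᵢ βᵢ` is counted 2 times by diagonal and 8 times by off-diagonal basis vectors, each `(aᵢ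
: bᵢ)` once by diagonal and 1 + 8 times by off-diagonal ones. -/
theorem trace_cross_cross (x w : H3) (T : H3 →ₗ[ℂ] H3) (hT : ∀ z, T z = cross (cross x z) w) :
    LinearMap.trace ℂ H3 T = 10 * bil x w := by
  have h (z : H3) : bil (T z) z = bil (cross x z) (cross w z) := by
    rw [hT, ← bil_cross_right]
  simp only [trace_eq, h, bil_cross_diag_single, bil_cross_off_single, Octonion.norm_unit,
    Finset.sum_add_distrib, Octonion.sum_bil_unit, Finset.sum_const, Finset.card_univ,
    Fintype.card_fin, one_mul]
  simp only [bil, Fin.sum_univ_three, Fin.isValue, Fin.reduceAdd, zero_add, nsmul_eq_mul]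
  push_cast
  ring

theorem trace_eq_of_apply (x w : H3) (T : H3 →ₗ[ℂ] H3)
    (hT : ∀ z, T z = bil x w • z + bil z w • x - cross (cross x z) w) :
    LinearMap.trace ℂ H3 T = 18 * bil x w := by
  have := Module.Finite.of_basis basis
  let φ : H3 →ₗ[ℂ] ℂ :=
    { toFun := fun z => bil z w
      map_add' := fun a b => bil_add_left a b w
      map_smul' := fun c a => bil_smul_left c a w }
  let C : H3 →ₗ[ℂ] H3 :=
    { toFun := fun z => cross (cross x z) w
      map_add' := fun a b => by rw [cross_add_right, cross_add_left]
      map_smul' := fun c a => by rw [cross_smul_right, cross_smul_left]; rfl }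
  have hC : T + C = bil x w • LinearMap.id + φ.smulRight x := by
    ext1 z
    simp [φ, C, hT]
  have hφ : LinearMap.trace ℂ H3 (φ.smulRight x) = bil x w := by
    rw [LinearMap.trace_smulRight]; rfl
  have hd : Module.finrank ℂ H3 = 27 := by
    rw [Module.finrank_eq_card_basis basis]; simp
  have h := congrArg (LinearMap.trace ℂ H3) hC
  rw [map_add, map_add, map_smul, hφ, LinearMap.trace_id, hd, smul_eq_mul,
    trace_cross_cross x w C fun _ => rfl] at h
  push_cast at h
  linear_combination h

/-! ### The quadratic operators and their composition formulas. -/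

/-- The quadratic operator `U_x z = (x : z) x - x# × z`. -/
noncomputable def U (x : H3) : H3 →ₗ[ℂ] H3 where
  toFun z := bil x z • x - cross (adj x) z
  map_add' y z := by
    simp only [bil_add_right, cross_add_right]
    module
  map_smul' c y := by
    simp only [bil_smul_right, cross_smul_right, RingHom.id_apply]
    module

/-- The linearization of the quadratic operator. -/
noncomputable def U₂ (x y : H3) : H3 →ₗ[ℂ] H3 where
  toFun z := bil y z • x + bil x z • y - cross (cross x y) z
  map_add' y z := by
    simp only [bil_add_right, cross_add_right]
    module
  map_smul' c y := by
    simp only [bil_smul_right, cross_smul_right, RingHom.id_apply]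
    module

/-- The bilinear version `D_{x, w} z = (x : w) z + (z : w) x - (x × z) × w` of `D`. -/
noncomputable def V (x w : H3) : H3 →ₗ[ℂ] H3 where
  toFun z := bil x w • z + bil z w • x - cross (cross x z) w
  map_add' y z := by
    simp only [bil_add_left, cross_add_right, cross_add_left]
    module
  map_smul' c y := by
    simp only [bil_smul_left, cross_smul_right, cross_smul_left, RingHom.id_apply]
    module

theorem U_apply (x z : H3) : U x z = bil x z • x - cross (adj x) z := rfl

theorem U₂_apply (x y z : H3) :
    U₂ x y z = bil y z • x + bil x z • y - cross (cross x y) z := rfl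

theorem V_apply (x w z : H3) :
    V x w z = bil x w • z + bil z w • x - cross (cross x z) w := rfl

theorem trace_V (x w : H3) : LinearMap.trace ℂ H3 (V x w) = 18 * bil x w :=
  trace_eq_of_apply x w _ fun _ => rfl

theorem U_add_smul (x y : H3) (t : ℂ) : U (x + t • y) = U x + t • U₂ x y + t ^ 2 • U y := by
  ext1 z
  simp only [LinearMap.add_apply, LinearMap.smul_apply, U_apply, U₂_apply, adj_add, adj_smul,
    bil_add_left, bil_smul_left, cross_add_left, cross_smul_left, cross_smul_right]
  module

theorem U_smul (c : ℂ) (x : H3) : U (c • x) = c ^ 2 • U x := by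
  ext1 z
  simp only [LinearMap.smul_apply, U_apply, adj_smul, bil_smul_left, cross_smul_left]
  module

theorem U₂_smul_left (c : ℂ) (x y : H3) : U₂ (c • x) y = c • U₂ x y := by
  ext1 z
  simp only [LinearMap.smul_apply, U₂_apply, bil_smul_left, cross_smul_left]
  module

theorem U_adj_self (x : H3) : U x (adj x) = det x • x := by
  rw [U_apply, cross_self, adj_adj, bil_comm, bil_adj_self]
  module

theorem U_cross (x z : H3) : U x (cross x z) = bil (adj x) z • x - det x • z := by
  rw [U_apply, cross_adj_cross, bil_cross_right, cross_self, bil_smul_left]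
  module

theorem U_comp_U_adj (x : H3) : U x ∘ₗ U (adj x) = det x ^ 2 • LinearMap.id := by
  ext1 z
  rw [LinearMap.comp_apply, U_apply (adj x), adj_adj, cross_smul_left, map_sub, map_smul, map_smul,
    U_adj_self, U_cross, LinearMap.smul_apply, LinearMap.id_apply]
  module

theorem U_comp_U₂_adj (x y : H3) : U x ∘ₗ U₂ (adj x) y = det x • V x y := by
  ext1 z
  have hb : cross x (cross (adj x) y) = bil x y • adj x + det x • y := cross_cross_adj x y
  -- This choice of the middle argument produces the term `x# × ((x# × y) × z)` arising from `U x`,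
  -- while `hb` reduces the companion product to a multiple of `cross_adj_cross` plus `det x • y ×
  -- (x × z)`.
  have h1 := cross_adj_cross_cross x (cross (adj x) y) z
  rw [hb, cross_add_left, cross_smul_left, cross_smul_left, cross_adj_cross, bil_cross_right,
    cross_self, adj_adj, bil_add_left, bil_smul_left, bil_smul_left, bil_smul_left,
    bil_smul_left] at h1
  have h2 : bil x (cross (cross (adj x) y) z) = bil x y * bil (adj x) z + det x * bil y z := by
    rw [bil_cross_right, hb, bil_add_left, bil_smul_left, bil_smul_left]
  rw [LinearMap.comp_apply, U₂_apply, map_sub, map_add, map_smul, map_smul, U_adj_self,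
    U_apply x y, U_apply x (cross _ z), h2, LinearMap.smul_apply, V_apply, cross_comm (cross x z) y,
    bil_comm z y]
  linear_combination (norm := module) h1

/-- The identity element of `H3`. -/
noncomputable def unit : H3 := of 1 0

theorem adj_unit : adj unit = unit := by
  refine H3_ext (fun i => ?_) (fun i => ?_)
  · simp [diag_adj, unit, Octonion.norm]
  · simp [off_adj, unit]

theorem det_unit : det unit = 1 := by
  simp [det_eq, unit, Octonion.norm, Octonion.bil_zero_left]

theorem U_unit : U unit = LinearMap.id := by
  ext1 z
  refine H3_ext (fun i => ?_) (fun i => ?_)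
  · rw [U_apply, adj_unit, diag_sub, diag_smul, diag_cross]
    fin_cases i <;> simp [unit, bil, Octonion.bil_zero_left, Fin.sum_univ_three] <;> ring
  · rw [U_apply, adj_unit]
    simp [unit, off_cross]

/-! ### Jacobi's formula and a differential equation for polynomials. -/

section PolynomialMatrices

open Polynomial

variable {n : Type} [Fintype n] [DecidableEq n] {R : Type} [CommRing R]

/-- Jacobi's formula for the derivative of a determinant of polynomials. -/
theorem derivative_matrix_det (M : Matrix n n R[X]) :
    derivative M.det = (M.adjugate * M.map derivative).trace := by
  -- By Cramer's rule each diagonal entry is the determinant with one column differentiated; what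
  -- remains is the product rule in the Leibniz expansion.
  have h (i : n) : (M.adjugate * M.map derivative) i i
      = (M.updateCol i fun j => derivative (M j i)).det := by
    rw [← Matrix.cramer_apply, Matrix.cramer_eq_adjugate_mulVec]
    rfl
  simp only [Matrix.trace, Matrix.diag_apply, h]
  simp only [Matrix.det_apply, derivative_sum]
  rw [Finset.sum_comm]
  refine Finset.sum_congr rfl fun σ _ => ?_
  rw [← Finset.smul_sum, Units.smul_def, map_zsmul, derivative_prod_finset, Units.smul_def]
  congr 1
  refine Finset.sum_congr rfl fun i _ => ?_
  rw [← Finset.prod_erase_mul _ _ (Finset.mem_univ i), Matrix.updateCol_self]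
  congr 1
  refine Finset.prod_congr rfl fun j hj => ?_
  rw [Matrix.updateCol_ne (Finset.ne_of_mem_erase hj)]

/-- The solutions of `g h' = k g' h` are determined by their value at a point where `g` does not
vanish. -/
theorem eq_zero_of_mul_derivative_eq [IsDomain R] [CharZero R] {g h : R[X]} (k : R[X])
    (hg : g.coeff 0 ≠ 0) (h0 : h.coeff 0 = 0) (e : g * derivative h = k * h) : h = 0 := by
  have key (m : ℕ) : ∀ i ≤ m, h.coeff i = 0 := by
    induction m with
    | zero => intro i hi; rw [Nat.le_zero.mp hi, h0]
    | succ m ih =>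
      intro i hi
      rcases Nat.lt_or_ge i (m + 1) with hlt | hge
      · exact ih i (Nat.lt_succ_iff.mp hlt)
      · obtain rfl : i = m + 1 := le_antisymm hi hge
        -- Once the coefficients of `h` up to `m` vanish, only `g.coeff 0 * (m + 1) * h.coeff (m +
        -- 1)` survives here.
        have hc := congrArg (fun p => coeff p m) e
        simp only [coeff_mul, coeff_derivative] at hc
        rw [Finset.sum_eq_zero (s := Finset.HasAntidiagonal.antidiagonal m) (f := fun x : ℕ × ℕ => k.coeff x.1 * h.coeff x.2),
          Finset.sum_eq_single (0, m)] at hc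
        · have : ((m : R) + 1) ≠ 0 := by exact_mod_cast Nat.succ_ne_zero m
          simpa [hg, this] using hc
        · rintro ⟨a, b⟩ hab hne
          have hab' : a + b = m := Finset.HasAntidiagonal.mem_antidiagonal.mp hab
          have : b + 1 ≤ m := by
            rcases Nat.eq_zero_or_pos a with rfl | ha
            · exact absurd (by simpa using hab') (by simpa using hne)
            · omega
          simp [ih _ this]
        · simp
        · rintro ⟨a, b⟩ hab
          have hab' : a + b = m := Finset.HasAntidiagonal.mem_antidiagonal.mp hab
          simp [ih b (by omega)]
  ext i
  simpa using key i i le_rfl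

/-- The difference `f - g ^ k` solves the same linear equation with initial value 0. -/
theorem eq_pow_of_mul_derivative_eq [IsDomain R] [CharZero R] {f g : R[X]} (k : ℕ)
    (hg : g.coeff 0 = 1) (hf : f.coeff 0 = 1) (e : g * derivative f = k * derivative g * f) :
    f = g ^ k := by
  refine sub_eq_zero.mp (eq_zero_of_mul_derivative_eq (g := g) (k * derivative g) ?_ ?_ ?_)
  · rw [hg]; exact one_ne_zero
  · rw [coeff_zero_eq_eval_zero] at hg hf ⊢
    rw [eval_sub, eval_pow, hf, hg, one_pow, sub_self]
  · rw [derivative_sub, derivative_pow, mul_sub, e]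
    cases k with
    | zero => simp
    | succ k =>
      simp only [Nat.add_sub_cancel, map_natCast]
      ring

end PolynomialMatrices

/-! ### Determinants of the quadratic and Bergman operators. -/

section

open Polynomial

/-- The matrix of a quadratic family of operators `T₀ + t T₁ + t² T₂`. -/
noncomputable def quadMatrix (T₀ T₁ T₂ : H3 →ₗ[ℂ] H3) :
    Matrix (Fin 3 ⊕ Fin 3 × Fin 8) (Fin 3 ⊕ Fin 3 × Fin 8) ℂ[X] :=
  Matrix.of fun i j => C (LinearMap.toMatrix basis basis T₀ i j)
    + X * C (LinearMap.toMatrix basis basis T₁ i j)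
    + X ^ 2 * C (LinearMap.toMatrix basis basis T₂ i j)

theorem quadMatrix_eval (T₀ T₁ T₂ : H3 →ₗ[ℂ] H3) (t : ℂ) :
    (quadMatrix T₀ T₁ T₂).map (eval t)
      = LinearMap.toMatrix basis basis (T₀ + t • T₁ + t ^ 2 • T₂) := by
  ext i j
  simp [quadMatrix]
  ring

theorem quadMatrix_derivative_eval (T₀ T₁ T₂ : H3 →ₗ[ℂ] H3) (t : ℂ) :
    ((quadMatrix T₀ T₁ T₂).map derivative).map (eval t)
      = LinearMap.toMatrix basis basis (T₁ + (2 * t) • T₂) := by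
  ext i j
  simp [quadMatrix]
  ring

theorem quadMatrix_det_eval (T₀ T₁ T₂ : H3 →ₗ[ℂ] H3) (t : ℂ) :
    eval t (quadMatrix T₀ T₁ T₂).det = LinearMap.det (T₀ + t • T₁ + t ^ 2 • T₂) := by
  rw [← LinearMap.det_toMatrix basis, ← quadMatrix_eval, ← coe_evalRingHom, RingHom.map_det]
  rfl

theorem quadMatrix_derivative_det_eval (T₀ T₁ T₂ S : H3 →ₗ[ℂ] H3) (t c : ℂ)
    (hS : (T₀ + t • T₁ + t ^ 2 • T₂) ∘ₗ S = c • LinearMap.id) :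
    c * eval t (derivative (quadMatrix T₀ T₁ T₂).det)
      = LinearMap.det (T₀ + t • T₁ + t ^ 2 • T₂)
        * LinearMap.trace ℂ H3 (S ∘ₗ (T₁ + (2 * t) • T₂)) := by
  set A := LinearMap.toMatrix basis basis (T₀ + t • T₁ + t ^ 2 • T₂) with hA
  set A' := LinearMap.toMatrix basis basis (T₁ + (2 * t) • T₂) with hA'
  have h1 : eval t (derivative (quadMatrix T₀ T₁ T₂).det) = (A.adjugate * A').trace := by
    rw [derivative_matrix_det, hA, hA', ← quadMatrix_eval, ← quadMatrix_derivative_eval T₀,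
      ← coe_evalRingHom, AddMonoidHom.map_trace, ← RingHom.mapMatrix_apply,
      ← RingHom.mapMatrix_apply, ← RingHom.map_adjugate, map_mul]
    rfl
  have h2 : A * LinearMap.toMatrix basis basis S = c • 1 := by
    rw [hA, ← LinearMap.toMatrix_comp, hS, map_smul, LinearMap.toMatrix_id]
  -- Multiplying `h2` by the adjugate avoids inverting `A`, so singular values of `t` are covered.
  have h3 : c • A.adjugate = A.det • LinearMap.toMatrix basis basis S := by
    have := congrArg (fun N => A.adjugate * N) h2
    simpa [← Matrix.mul_assoc, Matrix.adjugate_mul] using this.symm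
  rw [h1, LinearMap.trace_eq_matrix_trace ℂ basis, LinearMap.toMatrix_comp basis basis basis,
    ← LinearMap.det_toMatrix basis, ← hA, ← hA', ← smul_eq_mul, ← Matrix.trace_smul,
    ← Matrix.smul_mul, h3, Matrix.smul_mul, Matrix.trace_smul, smul_eq_mul]

/-- The determinant of a quadratic family of operators is a polynomial; its derivative is computed
by Jacobi's formula. -/
theorem exists_polynomial_det (T₀ T₁ T₂ : H3 →ₗ[ℂ] H3) : ∃ f : ℂ[X],
    (∀ t, eval t f = LinearMap.det (T₀ + t • T₁ + t ^ 2 • T₂)) ∧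
    ∀ (S : H3 →ₗ[ℂ] H3) (t c : ℂ), (T₀ + t • T₁ + t ^ 2 • T₂) ∘ₗ S = c • LinearMap.id →
      c * eval t (derivative f) = eval t f * LinearMap.trace ℂ H3 (S ∘ₗ (T₁ + (2 * t) • T₂)) :=
  ⟨(quadMatrix T₀ T₁ T₂).det, quadMatrix_det_eval T₀ T₁ T₂, fun S t c h => by
    rw [quadMatrix_det_eval, quadMatrix_derivative_det_eval _ _ _ S t c h]⟩

/-- The polynomial `t ↦ det (x + t y)`. -/
noncomputable def detPoly (x y : H3) : ℂ[X] :=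
  C (det x) + X * C (bil (adj x) y) + X ^ 2 * C (bil x (adj y)) + X ^ 3 * C (det y)

theorem detPoly_eval (x y : H3) (t : ℂ) : eval t (detPoly x y) = det (x + t • y) := by
  simp [detPoly, det_add_smul]
  ring

theorem detPoly_derivative_eval (x y : H3) (t : ℂ) :
    eval t (derivative (detPoly x y)) = bil (adj (x + t • y)) y := by
  simp only [detPoly, derivative_add, derivative_C, derivative_mul, derivative_X, derivative_X_pow,
    eval_add, eval_mul, eval_C, eval_X, eval_pow, eval_zero, adj_add, adj_smul, bil_add_left,
    bil_smul_left, cross_smul_right, bil_adj_self, ← bil_cross_right, cross_self, bil_smul_right]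
  simp
  ring

theorem detPoly_unit_coeff_zero (y : H3) : (detPoly unit y).coeff 0 = 1 := by
  rw [coeff_zero_eq_eval_zero, detPoly_eval, zero_smul, add_zero, det_unit]

theorem detPoly_unit_ne_zero (y : H3) : detPoly unit y ≠ 0 := fun h => by
  simpa [h] using detPoly_unit_coeff_zero y

theorem U₂_add_smul_left (x y : H3) (t : ℂ) : U₂ x y + (2 * t) • U y = U₂ (x + t • y) y := by
  ext1 z
  simp only [LinearMap.add_apply, LinearMap.smul_apply, U_apply, U₂_apply, cross_add_left,
    cross_smul_left, bil_add_left, bil_smul_left, cross_self]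
  module

/-- `U_comp_U₂_adj` at `adj x`, simplified by `adj_adj`: a division-free form of the logarithmic
derivative of `U` at `x` in the direction `y`. -/
theorem det_smul_U_adj_comp_U₂ (x y : H3) :
    (det x • U (adj x)) ∘ₗ U₂ x y = det x ^ 2 • V (adj x) y := by
  have := U_comp_U₂_adj (adj x) y
  rw [adj_adj, U₂_smul_left, LinearMap.comp_smul, det_adj] at this
  rw [LinearMap.smul_comp, this]

/-- `Det U_x = (det x)^18`. -/
theorem det_U (x : H3) : LinearMap.det (U x) = det x ^ 18 := by
  -- The line `unit + t • y` joins the unit element at `t = 0` to `x` at `t = 1`.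
  set y := x - unit
  obtain ⟨f, hf, hf'⟩ := exists_polynomial_det (U unit) (U₂ unit y) (U y)
  have hode : detPoly unit y * derivative f = (18 : ℕ) * derivative (detPoly unit y) * f := by
    -- The quasi-inverse in `h1` has scale `det ^ 3`, so the equation appears multiplied by `det ^
    -- 2`, which is cancelled as a nonzero polynomial.
    refine mul_left_cancel₀ (pow_ne_zero 2 (detPoly_unit_ne_zero y))
      (Polynomial.funext fun t => ?_)
    have h1 : (U unit + t • U₂ unit y + t ^ 2 • U y) ∘ₗ
        (det (unit + t • y) • U (adj (unit + t • y))) = det (unit + t • y) ^ 3 • LinearMap.id := by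
      rw [← U_add_smul, LinearMap.comp_smul, U_comp_U_adj, smul_smul]
      congr 1; ring
    have h2 := hf' _ _ _ h1
    rw [U₂_add_smul_left, det_smul_U_adj_comp_U₂, map_smul, trace_V, smul_eq_mul] at h2
    simp only [eval_mul, eval_pow, detPoly_eval, detPoly_derivative_eval, eval_natCast]
    push_cast
    linear_combination h2
  have h : f = detPoly unit y ^ 18 := by
    refine eq_pow_of_mul_derivative_eq 18 (detPoly_unit_coeff_zero y) ?_ hode
    rw [coeff_zero_eq_eval_zero, hf, ← U_add_smul, zero_smul, add_zero, U_unit, LinearMap.det_id]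
  have h1 := congrArg (eval 1) h
  rwa [eval_pow, hf, ← U_add_smul, detPoly_eval, one_smul, add_sub_cancel] at h1

/-- The bilinear version of the Bergman operator. -/
theorem bergman_comp (x w : H3) (hx : det x ≠ 0) :
    LinearMap.id - V x w + U x ∘ₗ U w = U x ∘ₗ U ((det x)⁻¹ • adj x + (-1 : ℂ) • w) := by
  rw [U_add_smul, U_smul, U₂_smul_left, LinearMap.comp_add, LinearMap.comp_add,
    LinearMap.comp_smul, LinearMap.comp_smul, LinearMap.comp_smul, LinearMap.comp_smul,
    U_comp_U_adj, U_comp_U₂_adj, smul_smul, smul_smul, smul_smul,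
    show (det x)⁻¹ ^ 2 * det x ^ 2 = 1 by field_simp,
    show -1 * (det x)⁻¹ * det x = -1 by field_simp]
  module

/-- The generic norm `Δ(x, w)`. -/
noncomputable def genericNorm (x w : H3) : ℂ :=
  1 - bil x w + bil (adj x) (adj w) - det x * det w

theorem det_bergman_of_det_ne_zero (x w : H3) (hx : det x ≠ 0) :
    LinearMap.det (LinearMap.id - V x w + U x ∘ₗ U w) = genericNorm x w ^ 18 := by
  have h : det x * det ((det x)⁻¹ • adj x + (-1 : ℂ) • w) = genericNorm x w := by
    have hs : det ((det x)⁻¹ • adj x) = (det x)⁻¹ := by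
      rw [det, adj_smul, adj_adj, bil_smul_left, bil_smul_left, bil_smul_right, bil_comm,
        bil_adj_self]
      field_simp
    rw [det_add_smul, hs, adj_smul, adj_adj, bil_smul_left, bil_smul_left, bil_smul_left,
      genericNorm]
    field_simp
    ring
  rw [bergman_comp x w hx, LinearMap.det_comp, det_U, det_U, ← mul_pow, h]

theorem det_bergman (x w : H3) :
    LinearMap.det (LinearMap.id - V x w + U x ∘ₗ U w) = genericNorm x w ^ 18 := by
  set y := x - unit with hy
  obtain ⟨f, hf, -⟩ := exists_polynomial_det (LinearMap.id - V unit w + U unit ∘ₗ U w)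
    (- V y w + U₂ unit y ∘ₗ U w) (U y ∘ₗ U w)
  have hfe (t : ℂ) : eval t f = LinearMap.det
      (LinearMap.id - V (unit + t • y) w + U (unit + t • y) ∘ₗ U w) := by
    rw [hf]
    congr 1
    ext1 z
    simp only [U_add_smul, LinearMap.add_apply, LinearMap.sub_apply, LinearMap.smul_apply,
      LinearMap.neg_apply, LinearMap.comp_apply, V_apply, bil_add_left, bil_smul_left,
      cross_add_left, cross_smul_left]
    module
  let d : ℂ[X] := C (1 - bil unit w + bil (adj unit) (adj w))
    + X * C (-bil y w + bil (cross unit y) (adj w)) + X ^ 2 * C (bil (adj y) (adj w))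
    - detPoly unit y * C (det w)
  have hd (t : ℂ) : eval t d = genericNorm (unit + t • y) w := by
    simp only [d, genericNorm, eval_sub, eval_add, eval_mul, eval_pow, eval_C, eval_X, detPoly_eval,
      adj_add, adj_smul, bil_add_left, bil_smul_left, cross_smul_right]
    ring
  have h : f = d ^ 18 := by
    -- Multiplying by the nonzero polynomial `detPoly unit y` makes the identity trivial at the
    -- values of `t` where the invertible case does not apply.
    refine mul_left_cancel₀ (detPoly_unit_ne_zero y) (Polynomial.funext fun t => ?_)
    rw [eval_mul, eval_mul, eval_pow, detPoly_eval, hd, hfe]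
    by_cases h0 : det (unit + t • y) = 0
    · rw [h0, zero_mul, zero_mul]
    · rw [det_bergman_of_det_ne_zero _ _ h0]
  have h1 := congrArg (eval 1) h
  rwa [eval_pow, hfe, hd, one_smul, hy, add_sub_cancel] at h1

end

/-! ### Complex conjugation and the passage to the bilinear operators. -/

theorem Octonion.conj_conj (a : Octonion ℂ) : Octonion.conj (Octonion.conj a) = a := by
  ext <;> simp [Octonion.conj]

theorem Octonion.bil_conj (a b : Octonion ℂ) :
    Octonion.bil (Octonion.conj a) (Octonion.conj b) = starRingEnd ℂ (Octonion.bil a b) := by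
  simp only [Octonion.bil_eq, Octonion.conj, map_mul, map_add, map_ofNat]
  rfl

theorem Octonion.conj_mul (a b : Octonion ℂ) :
    Octonion.conj (a * b) = Octonion.conj a * Octonion.conj b := by
  ext <;> simp [Octonion.conj]

theorem Octonion.conj_star (a : Octonion ℂ) :
    Octonion.conj (star a) = star (Octonion.conj a) := by
  ext <;> simp [Octonion.conj]

theorem diag_conj (a : H3) (i : Fin 3) : diag (conj a) i = starRingEnd ℂ (diag a i) := by
  simp [conj]

theorem off_conj (a : H3) (i : Fin 3) : off (conj a) i = Octonion.conj (off a i) := by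
  simp [conj]

theorem conj_conj (a : H3) : conj (conj a) = a :=
  H3_ext (fun i => by simp [diag_conj]) (fun i => by simp [off_conj, Octonion.conj_conj])

theorem bil_conj (a b : H3) : bil (conj a) (conj b) = starRingEnd ℂ (bil a b) := by
  simp [bil, diag_conj, off_conj, Octonion.bil_conj]

theorem conj_sub (a b : H3) : conj (a - b) = conj a - conj b := by
  rw [eq_sub_iff_add_eq, ← conj_add, sub_add_cancel]

theorem conj_cross (a b : H3) : conj (cross a b) = cross (conj a) (conj b) := by
  have hs (u v : Octonion ℂ) : Octonion.conj (u - v) = Octonion.conj u - Octonion.conj v := by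
    rw [eq_sub_iff_add_eq, ← Octonion.conj_add, sub_add_cancel]
  refine H3_ext (fun i => ?_) (fun i => ?_)
  · simp [diag_conj, diag_cross, off_conj, Octonion.bil_conj]
  · simp only [off_conj, off_cross, diag_conj, Octonion.conj_star, hs, Octonion.conj_add,
      Octonion.conj_mul, Octonion.conj_smul]

theorem conj_adj (a : H3) : conj (adj a) = adj (conj a) := by
  have h := congrArg conj (cross_self a)
  rw [conj_cross, cross_self, conj_smul, map_ofNat] at h
  exact (smul_right_injective H3 (two_ne_zero (α := ℂ)) h).symm

theorem D_eq (x y : H3) : D x y = V x (conj y) := rfl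

theorem B_eq (x y : H3) :
    B x y = LinearMap.id - V x (conj y) + U x ∘ₗ U (conj y) := by
  -- Since `Q x` is `U x` after `conj`, the two conjugations in the composite of `Q x` and `Q y` are
  -- absorbed by replacing `y` with `conj y`.
  have h (z : H3) : conj (Q y z) = U (conj y) z := by
    simp only [Q, U_apply, herm, LinearMap.coe_mk, AddHom.coe_mk, conj_sub, conj_smul, conj_cross,
      conj_adj, conj_conj, ← bil_conj]
  ext1 z
  have hQ : Q x (Q y z) = U x (U (conj y) z) := by
    rw [← h]; rfl
  simp only [B, D_eq, LinearMap.add_apply, LinearMap.sub_apply, LinearMap.comp_apply, hQ]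

end ExceptionalJordan

theorem mainTheorem4 (x y : ExceptionalJordan.H3) :
    LinearMap.trace ℂ ExceptionalJordan.H3 (ExceptionalJordan.D x y)
        = 18 * ExceptionalJordan.herm x y ∧
      LinearMap.det (ExceptionalJordan.B x y)
        = (1 - ExceptionalJordan.herm x y
            + ExceptionalJordan.herm (ExceptionalJordan.adj x) (ExceptionalJordan.adj y)
            - ExceptionalJordan.det x * ExceptionalJordan.det (ExceptionalJordan.conj y)) ^ 18 := by
  refine ⟨ExceptionalJordan.trace_V x _, ?_⟩
  rw [ExceptionalJordan.B_eq, ExceptionalJordan.det_bergman, ExceptionalJordan.genericNorm,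
    ExceptionalJordan.herm, ExceptionalJordan.herm, ExceptionalJordan.conj_adj]
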